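/- Let $\Sigma^+\neq\emptyset$ be a one-sided subshift of finite type on a finite alphabet, with shift map $\sigma:\Sigma^+\to\Sigma^+$, and assume that $\sigma$ is topologically mixing. Fix $0<\lambda<1$ and let $d(x,y)=\lambda^{n}$ with $n=\min\{k\ge 0: x_k\neq y_k\}$ for $x\ne y$, and $d(x,x)=0$. For $0<\alpha\le 1$ let $C^\alpha(\Sigma^+,\mathbb R)$ be the space of $\alpha$-Hölder functions $A:\Sigma^+\to\mathbb R$ with the norm $$\|A\|_\alpha=\sup_{0<d(x,y)\le 1}\frac{|A(x)-A(y)|}{d(x,y)^\alpha}+\sup_{x}|A(x)|,$$ and let $C^\alpha_0(\Sigma^+,\mathbb R)\subseteq C^\alpha(\Sigma^+,\mathbb R)$ be the subset of functions with zero topological pressure, with the induced topology. Here the topological pressure is $$P(A)=\lim_{n\to\infty}\frac1n\log\sum_{w}\exp\Big(\sup_{x\in[w]}\sum_{k=0}^{n-1}A(\sigma^k x)\Big),$$ where $w$ runs over the words of length $n$ whose cylinder $[w]\subseteq\Sigma^+$ is nonempty. Then there is a residual subset $\mathcal G_1$ of $C^\alpha_0(\Sigma^+,\mathbb R)$ such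 that every $A\in\mathcal G_1$ has exactly one maximizing measure $\mu$, that is, exactly one $\sigma$-invariant Borel probability $\mu$ with $$\int A\,d\mu=\max\Big\{\int A\,d\nu : \nu \text{ a } \sigma\text{-invariant Borel probability on }\Sigma^+\Big\},$$ and moreover the support of $\mu$ is uniquely ergodic: it is forward invariant under $\sigma$ and carries exactly one $\sigma$-invariant Borel probability. -/

import Mathlib

open MeasureTheory Filter Topology

noncomputable section

/-- A presentation of a one-sided subshift of finite type on the alphabet `{0, …, q - 1}`:
a window length and the set of words of that length which are allowed
(the finitely many other words of that length are the forbidden ones). -/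
structure SFT (q : ℕ) where
  window : ℕ
  allowed : Set (Fin window → Fin q)

namespace SFT

variable {q : ℕ} (F : SFT q)

/-- The set of one-sided sequences all of whose windows are allowed. It carries the topology and
the Borel σ-algebra induced from the product `ℕ → Fin q` of discrete spaces. -/
def space : Set (ℕ → Fin q) :=
  {x | ∀ k : ℕ, (fun i : Fin F.window => x (k + i)) ∈ F.allowed}

/-- The shift map `(x₀, x₁, x₂, …) ↦ (x₁, x₂, …)`. -/
def shift (x : F.space) : F.space :=
  ⟨fun n => x.1 (n + 1), fun k => by
    have h := x.2 (k + 1)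
    simpa only [Nat.add_right_comm] using h⟩

/-- Topological mixing of the shift map. -/
def TopologicallyMixing : Prop :=
  ∀ U V : Set F.space, IsOpen U → IsOpen V → U.Nonempty → V.Nonempty →
    ∃ N : ℕ, ∀ n ≥ N, (U ∩ F.shift^[n] ⁻¹' V).Nonempty

/-- The distance `d(x, y) = l ^ n` where `n` is the least index with `x n ≠ y n`,
and `d(x, x) = 0`. -/
def seqDist (l : ℝ) (x y : F.space) : ℝ :=
  open Classical in if x = y then 0 else l ^ PiNat.firstDiff x.1 y.1

/-- The quotients `|A x - A y| / d(x, y) ^ α` for `0 < d(x, y) ≤ 1`. -/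
def holderQuotients (l α : ℝ) (A : F.space → ℝ) : Set ℝ :=
  {r | ∃ x y : F.space, 0 < F.seqDist l x y ∧ F.seqDist l x y ≤ 1 ∧
    r = |A x - A y| / F.seqDist l x y ^ α}

/-- The Hölder seminorm `Hold_α(A)`. -/
def holderSeminorm (l α : ℝ) (A : F.space → ℝ) : ℝ :=
  sSup (F.holderQuotients l α A)

/-- The supremum norm `‖A‖₀`. -/
def supNorm (A : F.space → ℝ) : ℝ :=
  sSup (Set.range fun x => |A x|)

/-- The functions for which the suprema defining `‖A‖₀` and `Hold_α(A)` are both finite. -/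
def IsHolder (l α : ℝ) (A : F.space → ℝ) : Prop :=
  BddAbove (Set.range fun x => |A x|) ∧ BddAbove (F.holderQuotients l α A)

variable {F} {l α : ℝ} {A B : F.space → ℝ}

theorem supNorm_nonneg : 0 ≤ F.supNorm A := by
  refine Real.sSup_nonneg ?_
  rintro _ ⟨x, rfl⟩
  exact abs_nonneg _

theorem holderSeminorm_nonneg : 0 ≤ F.holderSeminorm l α A := by
  refine Real.sSup_nonneg ?_
  rintro _ ⟨x, y, h, -, rfl⟩
  positivity

theorem IsHolder.abs_le (hA : F.IsHolder l α A) (x : F.space) : |A x| ≤ F.supNorm A :=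
  le_csSup hA.1 ⟨x, rfl⟩

theorem IsHolder.quot_le (hA : F.IsHolder l α A) (x y : F.space) (h : 0 < F.seqDist l x y)
    (h' : F.seqDist l x y ≤ 1) :
    |A x - A y| / F.seqDist l x y ^ α ≤ F.holderSeminorm l α A :=
  le_csSup hA.2 ⟨x, y, h, h', rfl⟩

theorem IsHolder.add_abs_le (hA : F.IsHolder l α A) (hB : F.IsHolder l α B) :
    ∀ r ∈ Set.range (fun x => |(A + B) x|), r ≤ F.supNorm A + F.supNorm B := by
  rintro _ ⟨x, rfl⟩
  exact (abs_add_le _ _).trans (add_le_add (hA.abs_le x) (hB.abs_le x))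

theorem IsHolder.add_quot_le (hA : F.IsHolder l α A) (hB : F.IsHolder l α B) :
    ∀ r ∈ F.holderQuotients l α (A + B),
      r ≤ F.holderSeminorm l α A + F.holderSeminorm l α B := by
  rintro _ ⟨x, y, h, h', rfl⟩
  refine le_trans ?_ (add_le_add (hA.quot_le x y h h') (hB.quot_le x y h h'))
  rw [← add_div]
  have hp : 0 < F.seqDist l x y ^ α := Real.rpow_pos_of_pos h α
  refine div_le_div_of_nonneg_right ?_ hp.le
  have e : (A + B) x - (A + B) y = (A x - A y) + (B x - B y) := by
    simp only [Pi.add_apply]; ring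
  rw [e]
  exact abs_add_le _ _

theorem IsHolder.add (hA : F.IsHolder l α A) (hB : F.IsHolder l α B) :
    F.IsHolder l α (A + B) :=
  ⟨⟨_, hA.add_abs_le hB⟩, ⟨_, hA.add_quot_le hB⟩⟩

theorem IsHolder.zero : F.IsHolder l α 0 := by
  refine ⟨⟨0, ?_⟩, ⟨0, ?_⟩⟩
  · rintro _ ⟨x, rfl⟩
    simp
  · rintro _ ⟨x, y, -, -, rfl⟩
    simp

theorem IsHolder.smul (c : ℝ) (hA : F.IsHolder l α A) : F.IsHolder l α (c • A) := by
  refine ⟨⟨|c| * F.supNorm A, ?_⟩, ⟨|c| * F.holderSeminorm l α A, ?_⟩⟩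
  · rintro _ ⟨x, rfl⟩
    simp only [Pi.smul_apply, smul_eq_mul, abs_mul]
    exact mul_le_mul_of_nonneg_left (hA.abs_le x) (abs_nonneg c)
  · rintro _ ⟨x, y, h, h', rfl⟩
    simp only [Pi.smul_apply, smul_eq_mul, ← mul_sub, abs_mul, mul_div_assoc]
    exact mul_le_mul_of_nonneg_left (hA.quot_le x y h h') (abs_nonneg c)

theorem supNorm_neg : F.supNorm (-A) = F.supNorm A := by
  simp [supNorm]

theorem holderSeminorm_neg : F.holderSeminorm l α (-A) = F.holderSeminorm l α A := by
  have e : ∀ x y : F.space, |(-A) x - (-A) y| = |A x - A y| := fun x y => by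
    rw [Pi.neg_apply, Pi.neg_apply, ← abs_neg]
    congr 1
    ring
  simp only [holderSeminorm, holderQuotients, e]

variable (F l α)

/-- The space of `α`-Hölder functions, as a linear subspace of all functions. -/
def holderSubmodule : Submodule ℝ (F.space → ℝ) where
  carrier := {A | F.IsHolder l α A}
  add_mem' hA hB := IsHolder.add hA hB
  zero_mem' := IsHolder.zero
  smul_mem' c _ hA := IsHolder.smul c hA

/-- The space `C^α` of `α`-Hölder functions, to be endowed with the `α`-Hölder norm
(and not with the topology of pointwise convergence). -/
def HolderSpace : Type := F.holderSubmodule l α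

variable {F l α}

instance : AddCommGroup (F.HolderSpace l α) :=
  inferInstanceAs (AddCommGroup (F.holderSubmodule l α))

instance : Module ℝ (F.HolderSpace l α) :=
  inferInstanceAs (Module ℝ (F.holderSubmodule l α))

instance : CoeFun (F.HolderSpace l α) (fun _ => F.space → ℝ) := ⟨fun A => A.1⟩

/-- The `α`-Hölder norm `‖A‖_α = Hold_α(A) + ‖A‖₀`. -/
def holderNorm : AddGroupNorm (F.HolderSpace l α) where
  toFun A := F.holderSeminorm l α A + F.supNorm A
  map_zero' := by
    have h1 : F.holderSeminorm l α (0 : F.space → ℝ) = 0 := by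
      refine le_antisymm (Real.sSup_le ?_ le_rfl) holderSeminorm_nonneg
      rintro _ ⟨x, y, -, -, rfl⟩
      simp
    have h2 : F.supNorm (0 : F.space → ℝ) = 0 := by
      refine le_antisymm (Real.sSup_le ?_ le_rfl) supNorm_nonneg
      rintro _ ⟨x, rfl⟩
      simp
    change F.holderSeminorm l α (0 : F.space → ℝ) + F.supNorm (0 : F.space → ℝ) = 0
    rw [h1, h2, add_zero]
  add_le' A B := by
    change F.holderSeminorm l α (A.1 + B.1) + F.supNorm (A.1 + B.1) ≤ _
    have h1 : F.holderSeminorm l α (A.1 + B.1) ≤ _ :=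
      Real.sSup_le (A.2.add_quot_le B.2) (add_nonneg holderSeminorm_nonneg holderSeminorm_nonneg)
    have h2 : F.supNorm (A.1 + B.1) ≤ _ :=
      Real.sSup_le (A.2.add_abs_le B.2) (add_nonneg supNorm_nonneg supNorm_nonneg)
    linarith
  neg' A := by
    change F.holderSeminorm l α (-A.1) + F.supNorm (-A.1) = _
    rw [holderSeminorm_neg, supNorm_neg]
  eq_zero_of_map_eq_zero' A h := by
    have h1 : 0 ≤ F.holderSeminorm l α A.1 := holderSeminorm_nonneg
    have h2 : F.supNorm A.1 ≤ 0 := by linarith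
    refine Subtype.ext (funext fun x => ?_)
    exact abs_eq_zero.1 (le_antisymm ((IsHolder.abs_le A.2 x).trans h2) (abs_nonneg _))

instance : NormedAddCommGroup (F.HolderSpace l α) :=
  holderNorm.toNormedAddCommGroup

variable (F)

/-- The cylinder of the points of the subshift that begin with the word `w`. -/
def cylinder {n : ℕ} (w : Fin n → Fin q) : Set F.space :=
  {x | ∀ i : Fin n, x.1 i = w i}

/-- The partition function: the sum, over the words `w` of length `n` that occur in the subshift,
of `exp (sup_{x ∈ [w]} ∑_{k < n} A (σᵏ x))`. -/
def partitionFunction (A : F.space → ℝ) (n : ℕ) : ℝ :=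
  open Classical in
  ∑ w ∈ (Finset.univ : Finset (Fin n → Fin q)).filter (fun w => (F.cylinder w).Nonempty),
    Real.exp (sSup (birkhoffSum F.shift A n '' F.cylinder w))

/-- The topological pressure `P(A)` of a bounded function on the subshift
(for a nonempty subshift the sequence is bounded, and for continuous `A` it converges). -/
def pressure (A : F.space → ℝ) : ℝ :=
  limsup (fun n : ℕ => Real.log (F.partitionFunction A n) / n) atTop

/-- The set `C^α_0` of the `α`-Hölder functions with zero topological pressure. -/
def zeroPressure (l α : ℝ) : Set (F.HolderSpace l α) :=
  {A | F.pressure A = 0}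

/-- The shift-invariant Borel probability measures. -/
def invariantProb : Set (Measure F.space) :=
  {ν | IsProbabilityMeasure ν ∧ MeasurePreserving F.shift ν ν}

/-- The maximizing measures of `A`: the invariant probabilities at which
`ν ↦ ∫ A dν` attains its maximum over all invariant probabilities. -/
def maximizingMeasures (A : F.space → ℝ) : Set (Measure F.space) :=
  {μ | μ ∈ F.invariantProb ∧ ∀ ν ∈ F.invariantProb, ∫ x, A x ∂ν ≤ ∫ x, A x ∂μ}

/-- A set `K` is uniquely ergodic if it is forward invariant and carries exactly one
shift-invariant Borel probability. -/
def UniquelyErgodicOn (K : Set F.space) : Prop :=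
  Set.MapsTo F.shift K K ∧ ∃! ν : Measure F.space, ν ∈ F.invariantProb ∧ ν Kᶜ = 0

end SFT

end

/-!
Let `β A` be the largest integral of `A` over the invariant probabilities. Two maximizing measures
of `A` with different integrals of `e` produce a corner of `t ↦ β (A + t e)` at `t = 0`. As `β` is
Lipschitz, its restriction to a line is differentiable almost everywhere, so the absence of such a
corner is a dense `Gδ` condition on `A`. It is unchanged when a constant is added to `A`, and so
passes to the functions of zero pressure, onto which `A ↦ A - P(A)` retracts. Imposing it for the
countably many indicators `e` of cylinders leaves a single maximizing measure `μ`.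

By Mañé's lemma there is a continuous `V` with `A + V ≤ V ∘ σ + β A`. Integrating shows that
equality holds on the support of `μ`, so every invariant probability carried by the support is
maximizing, hence equal to `μ`.
-/

/-! ### Invariant measures of continuous maps -/

section InvariantMeasures

variable {X Y : Type*} [TopologicalSpace X] [MeasurableSpace X] [TopologicalSpace Y]
  [MeasurableSpace Y] {T : X → X}

theorem mapsTo_support_of_measurePreserving [OpensMeasurableSpace Y] {f : X → Y} {μ : Measure X}
    {ν : Measure Y} (hf : Continuous f) (hμν : MeasurePreserving f μ ν) :
    Set.MapsTo f μ.support ν.support := by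
  intro x hx
  rw [Measure.mem_support_iff_forall] at hx ⊢
  intro U hU
  obtain ⟨W, hWU, hW, hxW⟩ := mem_nhds_iff.1 hU
  calc 0 < μ (f ⁻¹' W) := hx _ (hf.continuousAt.preimage_mem_nhds (hW.mem_nhds hxW))
    _ = ν W := hμν.measure_preimage hW.measurableSet.nullMeasurableSet
    _ ≤ ν U := measure_mono hWU

theorem exists_invariantProb_of_iterate_eq {X : Type*} [MeasurableSpace X]
    [MeasurableSingletonClass X] {T : X → X} (hT : Measurable T) {n : ℕ} (hn : 0 < n) {p : X}
    (hp : T^[n] p = p) :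
    ∃ ν : Measure X, IsProbabilityMeasure ν ∧ MeasurePreserving T ν ν ∧
      ∀ f : X → ℝ, ∫ x, f x ∂ν = birkhoffSum T f n p / n := by
  have hn0 : (n : ENNReal) ≠ 0 := by exact_mod_cast hn.ne'
  let ν : Measure X := (n : ENNReal)⁻¹ • ∑ i ∈ Finset.range n, Measure.dirac (T^[i] p)
  refine ⟨ν, ⟨?_⟩, ⟨hT, ?_⟩, fun f => ?_⟩
  · simp [ν, ENNReal.inv_mul_cancel hn0 (ENNReal.natCast_ne_top n)]
  · have hcycle : ∑ i ∈ Finset.range n, Measure.dirac (T^[i + 1] p) =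
        ∑ i ∈ Finset.range n, Measure.dirac (T^[i] p) := by
      obtain ⟨m, rfl⟩ := Nat.exists_eq_add_one.2 hn
      rw [Finset.sum_range_succ, Finset.sum_range_succ', hp, Function.iterate_zero_apply]
    simp only [ν, Measure.map_smul, Measure.map_finset_sum hT.aemeasurable,
      Measure.map_dirac' hT, ← Function.iterate_succ_apply', hcycle]
  · rw [integral_smul_measure, integral_finsetSum_measure fun i _ => integrable_dirac (by simp)]
    simp only [integral_dirac, birkhoffSum, smul_eq_mul, ENNReal.toReal_inv,
      ENNReal.toReal_natCast, div_eq_inv_mul]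

variable [CompactSpace X] [BorelSpace X]

theorem integrable_of_continuous_of_compactSpace {f : X → ℝ} (hf : Continuous f) (μ : Measure X)
    [IsFiniteMeasure μ] : Integrable f μ :=
  (BoundedContinuousFunction.mkOfCompact ⟨f, hf⟩).integrable μ

theorem exists_invariantProb_forall_integral_le [HasOuterApproxClosed X] [T2Space X]
    (hT : Continuous T)
    (hne : ∃ ν : Measure X, IsProbabilityMeasure ν ∧ MeasurePreserving T ν ν) {f : X → ℝ}
    (hf : Continuous f) :
    ∃ μ : Measure X, (IsProbabilityMeasure μ ∧ MeasurePreserving T μ μ) ∧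
      ∀ ν : Measure X, IsProbabilityMeasure ν ∧ MeasurePreserving T ν ν →
        ∫ x, f x ∂ν ≤ ∫ x, f x ∂μ := by
  let S : Set (ProbabilityMeasure X) := {ν | ν.map hT.measurable.aemeasurable = ν}
  have mem_S : ∀ ν : ProbabilityMeasure X, MeasurePreserving T (ν : Measure X) ν → ν ∈ S :=
    fun ν h => Subtype.ext h.map_eq
  have hS : IsCompact S :=
    (isClosed_eq (ProbabilityMeasure.continuous_map hT) continuous_id).isCompact
  obtain ⟨ν₀, hν₀, hν₀T⟩ := hne
  obtain ⟨μ, hμ, hmax⟩ := hS.exists_isMaxOn ⟨⟨ν₀, hν₀⟩, mem_S ⟨ν₀, hν₀⟩ hν₀T⟩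
    (ProbabilityMeasure.continuous_integral_boundedContinuousFunction
      (BoundedContinuousFunction.mkOfCompact ⟨f, hf⟩)).continuousOn
  exact ⟨μ, ⟨inferInstance, hT.measurable, congrArg Subtype.val hμ⟩,
    fun ν hν => hmax (mem_S ⟨ν, hν.1⟩ hν.2)⟩

theorem integral_eq_of_support_of_le_coboundary (hT : Continuous T) {f V : X → ℝ} {m : ℝ}
    (hf : Continuous f) (hV : Continuous V) (hfV : ∀ x, f x + V x ≤ V (T x) + m)
    {μ ν : Measure X} [IsProbabilityMeasure μ] [IsProbabilityMeasure ν]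
    (hμ : MeasurePreserving T μ μ) (hν : MeasurePreserving T ν ν) (hμm : ∫ x, f x ∂μ = m)
    (hνμ : ν μ.supportᶜ = 0) : ∫ x, f x ∂ν = m := by
  let g : X → ℝ := fun x => V (T x) - V x + (m - f x)
  have hg : Continuous g := by fun_prop
  have integral_g (η : Measure X) [IsProbabilityMeasure η] (hη : MeasurePreserving T η η) :
      ∫ x, g x ∂η = m - ∫ x, f x ∂η := by
    have hVT : ∫ x, V (T x) ∂η = ∫ x, V x ∂η := by
      rw [← integral_map hT.aemeasurable hV.aestronglyMeasurable, hη.map_eq]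
    have integrable {h : X → ℝ} (hh : Continuous h) : Integrable h η :=
      integrable_of_continuous_of_compactSpace hh η
    rw [integral_add (integrable (by fun_prop)) (integrable (by fun_prop)),
      integral_sub (integrable (by fun_prop)) (integrable hV),
      integral_sub (integrable_const m) (integrable hf), hVT, sub_self, zero_add]
    simp
  have hg_nonneg : ∀ x, 0 ≤ g x := fun x => by linarith [hfV x]
  have hgμ : g =ᵐ[μ] 0 := by
    rw [← integral_eq_zero_iff_of_nonneg hg_nonneg
      (integrable_of_continuous_of_compactSpace hg μ), integral_g μ hμ, hμm, sub_self]
  have hg_support : μ.support ⊆ {x | g x = 0} :=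
    Measure.support_subset_of_isClosed (isClosed_eq hg continuous_const) hgμ
  have hgν : ∫ x, g x ∂ν = 0 :=
    integral_eq_zero_of_ae ((ae_iff.2 hνμ : ∀ᵐ x ∂ν, x ∈ μ.support).mono hg_support)
  linarith [integral_g ν hν]

end InvariantMeasures

/-! ### Points without a corner -/

section SmoothAlong

variable {E : Type*}

/-- `Φ` has no upward corner at `a` in the direction `e`: some symmetric second difference along
`e` is arbitrarily small compared with its step `t`. For convex `Φ` this is the existence of the
two-sided derivative along `e`, but unlike the latter it is visibly a `Gδ` condition on `a`. -/
def IsSmoothAlong [AddCommGroup E] [Module ℝ E] (Φ : E → ℝ) (e a : E) : Prop :=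
  ∀ η > 0, ∃ t > 0, Φ (a + t • e) + Φ (a - t • e) - 2 * Φ a < t * η

theorem IsSmoothAlong.add_smul [AddCommGroup E] [Module ℝ E] {Φ : E → ℝ} {u e a : E}
    (hΦu : ∀ (a : E) (c : ℝ), Φ (a + c • u) = Φ a + c) (h : IsSmoothAlong Φ e a) (c : ℝ) :
    IsSmoothAlong Φ e (a + c • u) := by
  intro η hη
  obtain ⟨t, ht, hlt⟩ := h η hη
  refine ⟨t, ht, ?_⟩
  rw [add_right_comm a, add_sub_right_comm a, hΦu, hΦu, hΦu]
  linarith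

theorem isSmoothAlong_of_lineDifferentiableAt [AddCommGroup E] [Module ℝ E] {Φ : E → ℝ} {e a : E}
    (h : LineDifferentiableAt ℝ Φ a e) : IsSmoothAlong Φ e a := by
  intro η hη
  have hright : HasDerivAt (fun t : ℝ => Φ (a + t • e)) (lineDeriv ℝ Φ a e) 0 := h.hasLineDerivAt
  have hleft : HasDerivAt (fun t : ℝ => Φ (a - t • e)) (-lineDeriv ℝ Φ a e) 0 := by
    simpa [HasLineDerivAt, sub_eq_add_neg] using h.hasLineDerivAt.smul (-1)
  have hsum := hright.fun_add hleft
  rw [add_neg_cancel] at hsum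
  have hsmall := (hasDerivAt_iff_isLittleO.1 hsum).def (half_pos hη)
  obtain ⟨t, hlt, ht⟩ :=
    ((hsmall.filter_mono nhdsWithin_le_nhds).and (self_mem_nhdsWithin (s := Set.Ioi 0))).exists
  have ht : 0 < t := ht
  refine ⟨t, ht, ?_⟩
  simp only [zero_smul, add_zero, sub_zero, smul_zero, Real.norm_eq_abs, abs_of_pos ht] at hlt
  nlinarith [(abs_le.1 hlt).2, mul_pos ht hη]

theorem dense_setOf_lineDifferentiableAt [NormedAddCommGroup E] [NormedSpace ℝ E] {Φ : E → ℝ}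
    {K : NNReal} (hΦ : LipschitzWith K Φ) (e : E) : Dense {a | LineDifferentiableAt ℝ Φ a e} := by
  intro a
  let line : ℝ → E := fun s => a + s • e
  have hline : LipschitzWith ‖e‖₊ line := LipschitzWith.of_dist_le_mul fun s t => by
    simp [line, dist_eq_norm, ← sub_smul, norm_smul, mul_comm]
  have hdense : Dense {s | DifferentiableAt ℝ (Φ ∘ line) s} :=
    Measure.dense_of_ae (hΦ.comp hline).ae_differentiableAt_real
  have hmaps : Set.MapsTo line {s | DifferentiableAt ℝ (Φ ∘ line) s}
      {a | LineDifferentiableAt ℝ Φ a e} := fun s hs => by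
    have hs : DifferentiableAt ℝ (Φ ∘ line) (s + 0) := by simpa using hs
    simpa [LineDifferentiableAt, Function.comp_def, line, add_smul, add_assoc] using
      (differentiableAt_comp_add_left s).2 hs
  simpa [line] using map_mem_closure hline.continuous (hdense 0) hmaps

theorem isGδ_setOf_isSmoothAlong [AddCommGroup E] [Module ℝ E] [TopologicalSpace E]
    [IsTopologicalAddGroup E] {Φ : E → ℝ} (hΦ : Continuous Φ) (e : E) :
    IsGδ {a | IsSmoothAlong Φ e a} := by
  have hset : {a | IsSmoothAlong Φ e a} =
      ⋂ k : ℕ, ⋃ t > 0, {a | Φ (a + t • e) + Φ (a - t • e) - 2 * Φ a < t * (1 / (k + 1))} := by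
    ext a
    simp only [Set.mem_iInter, Set.mem_iUnion, Set.mem_ofPred_eq, exists_prop]
    refine ⟨fun h k => h _ Nat.one_div_pos_of_nat, fun h η hη => ?_⟩
    obtain ⟨k, hk⟩ := exists_nat_one_div_lt hη
    obtain ⟨t, ht, hlt⟩ := h k
    exact ⟨t, ht, hlt.trans (mul_lt_mul_of_pos_left hk ht)⟩
  rw [hset]
  exact .iInter_of_isOpen fun k => isOpen_biUnion fun t _ => isOpen_lt (by fun_prop) (by fun_prop)

theorem dense_preimage_val_zeroLevel [AddCommGroup E] [Module ℝ E] [TopologicalSpace E]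
    [ContinuousAdd E] [ContinuousSMul ℝ E] {P : E → ℝ} (hP : Continuous P) {u : E}
    (hPu : ∀ (a : E) (c : ℝ), P (a + c • u) = P a + c) {s : Set E} (hs : Dense s)
    (hsu : ∀ a ∈ s, ∀ c : ℝ, a + c • u ∈ s) :
    Dense ((↑) ⁻¹' s : Set {a | P a = 0}) := by
  let r : E → {a | P a = 0} := fun a => ⟨a + (-P a) • u, (hPu a _).trans (add_neg_cancel _)⟩
  have hr : Continuous r := by fun_prop
  have hr_surj : Function.Surjective r := fun z => ⟨z, Subtype.ext (by simp [r, z.2.out])⟩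
  refine (hr_surj.denseRange.dense_image hr hs).mono ?_
  rintro _ ⟨a, ha, rfl⟩
  exact hsu a ha _

theorem setOf_isSmoothAlong_mem_residual_zeroLevel [NormedAddCommGroup E] [NormedSpace ℝ E]
    {Φ P : E → ℝ} {K : NNReal} {u : E} (hΦ : LipschitzWith K Φ) (hP : Continuous P)
    (hΦu : ∀ (a : E) (c : ℝ), Φ (a + c • u) = Φ a + c)
    (hPu : ∀ (a : E) (c : ℝ), P (a + c • u) = P a + c) (e : E) :
    {a : {a | P a = 0} | IsSmoothAlong Φ e a} ∈ residual {a | P a = 0} :=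
  residual_of_dense_Gδ ((isGδ_setOf_isSmoothAlong hΦ.continuous e).preimage continuous_subtype_val)
    (dense_preimage_val_zeroLevel hP hPu
      ((dense_setOf_lineDifferentiableAt hΦ e).mono fun _ => isSmoothAlong_of_lineDifferentiableAt)
      fun _ ha c => IsSmoothAlong.add_smul hΦu ha c)

end SmoothAlong

/-! ### Birkhoff sums -/

theorem birkhoffSum_le_add_mul {X : Type*} {T : X → X} {f g : X → ℝ} {c : ℝ}
    (h : ∀ x, f x ≤ g x + c) (n : ℕ) (x : X) :
    birkhoffSum T f n x ≤ birkhoffSum T g n x + n * c := by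
  simpa [birkhoffSum, Finset.sum_add_distrib] using
    Finset.sum_le_sum (s := Finset.range n) fun k _ => h (T^[k] x)

theorem birkhoffSum_le_card_mul {X W : Type*} {T : X → X} {f : X → ℝ} {c : X → W} {K D : ℝ}
    (hD0 : 0 ≤ D) (hD : ∀ x, f x ≤ D)
    (hreturn : ∀ n x, c (T^[n] x) = c x → birkhoffSum T f n x ≤ K) (s : Finset W) (n : ℕ) (x : X)
    (hs : ∀ i < n, c (T^[i] x) ∈ s) : birkhoffSum T f n x ≤ s.card * (K + D) := by
  classical
  induction s using Finset.strongInduction generalizing n x with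
  | H s ih =>
  have hK0 : 0 ≤ K := by simpa using hreturn 0 x rfl
  rcases n.eq_zero_or_pos with rfl | hn
  · simpa using mul_nonneg (Nat.cast_nonneg s.card) (add_nonneg hK0 hD0)
  -- Cut the orbit at its last visit `m` to the letter it starts from.
  let m := Nat.findGreatest (fun i => c (T^[i] x) = c x) (n - 1)
  have hm : c (T^[m] x) = c x :=
    Nat.findGreatest_spec (P := fun i => c (T^[i] x) = c x) (n - 1).zero_le rfl
  have hmn : m ≤ n - 1 := Nat.findGreatest_le _
  have hxs : c x ∈ s := hs 0 hn
  have hlast : birkhoffSum T f (n - (m + 1)) (T^[m + 1] x) ≤ (s.erase (c x)).card * (K + D) := by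
    refine ih _ (Finset.erase_ssubset hxs) _ _ fun i hi => ?_
    rw [← Function.iterate_add_apply]
    have hnot : c (T^[i + (m + 1)] x) ≠ c x :=
      Nat.findGreatest_is_greatest (show m < i + (m + 1) by omega) (by omega)
    exact Finset.mem_erase.2 ⟨hnot, hs _ (by omega)⟩
  calc birkhoffSum T f n x
      = birkhoffSum T f m x + f (T^[m] x) + birkhoffSum T f (n - (m + 1)) (T^[m + 1] x) := by
        rw [← birkhoffSum_succ, ← birkhoffSum_add, Nat.add_sub_cancel' (by omega)]
    _ ≤ K + D + (s.erase (c x)).card * (K + D) :=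
        add_le_add (add_le_add (hreturn m x hm) (hD _)) hlast
    _ = s.card * (K + D) := by
        rw [← Finset.card_erase_add_one hxs]
        push_cast
        ring

/-! ### Subshifts of finite type -/

namespace SFT

variable {q : ℕ} {F : SFT q}

theorem shift_iterate_apply (n : ℕ) (x : F.space) (i : ℕ) :
    (F.shift^[n] x).1 i = x.1 (i + n) := by
  induction n generalizing x with
  | zero => rfl
  | succ n ih => rw [Function.iterate_succ_apply, ih, shift, ← add_assoc]

theorem continuous_shift : Continuous F.shift :=
  continuous_induced_rng.2 (continuous_pi fun n =>
    (continuous_apply (n + 1)).comp continuous_subtype_val)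

theorem mem_space_of_windows {z : ℕ → Fin q}
    (hz : ∀ k, ∃ x : F.space, ∀ i < F.window, z (k + i) = x.1 i) : z ∈ F.space := by
  intro k
  obtain ⟨x, hx⟩ := hz k
  simpa only [zero_add, hx _ (Fin.is_lt _)] using x.2 0

theorem isClosed_space : IsClosed F.space := by
  have h : F.space = ⋂ k : ℕ, (fun x (i : Fin F.window) => x (k + i)) ⁻¹' F.allowed := by
    ext x
    simp only [space, Set.mem_ofPred_eq, Set.mem_iInter, Set.mem_preimage]
  rw [h]
  exact isClosed_iInter fun k => (isClosed_discrete _).preimage (by fun_prop)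

instance : CompactSpace F.space :=
  isCompact_iff_compactSpace.1 isClosed_space.isCompact

theorem isClopen_cylinder {n : ℕ} (w : Fin n → Fin q) : IsClopen (F.cylinder w) := by
  have h : F.cylinder w = ⋂ i : Fin n, (fun x : F.space => x.1 i) ⁻¹' {w i} := by
    ext x
    simp only [cylinder, Set.mem_ofPred_eq, Set.mem_iInter, Set.mem_preimage,
      Set.mem_singleton_iff]
  rw [h]
  exact isClopen_iInter_of_finite fun i =>
    (isClopen_discrete _).preimage ((continuous_apply _).comp continuous_subtype_val)

theorem exists_replace_tail (n : ℕ) (y x : F.space) {k : ℕ} (hk : F.window ≤ k)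
    (h : (F.shift^[n] y).1 ∈ PiNat.cylinder x.1 k) :
    ∃ z : F.space, F.shift^[n] z = x ∧ z.1 ∈ PiNat.cylinder y.1 (n + k) := by
  let z : ℕ → Fin q := fun i => if i < n then y.1 i else x.1 (i - n)
  have hzx : ∀ i, z (i + n) = x.1 i := fun i => by simp [z]
  have hzy : ∀ i < n + k, z i = y.1 i := fun i hi => by
    rcases lt_or_ge i n with hin | hin
    · exact if_pos hin
    · obtain ⟨j, rfl⟩ := Nat.exists_eq_add_of_le' hin
      rw [hzx, ← h j (by omega), shift_iterate_apply]
  have hz : z ∈ F.space := mem_space_of_windows fun j => by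
    rcases lt_or_ge j n with hjn | hjn
    · exact ⟨F.shift^[j] y, fun i hi => by
        rw [hzy _ (by omega), shift_iterate_apply, add_comm]⟩
    · exact ⟨F.shift^[j - n] x, fun i _ => by
        rw [shift_iterate_apply, ← hzx, add_assoc, Nat.sub_add_cancel hjn, add_comm]⟩
  exact ⟨⟨z, hz⟩, Subtype.ext (funext fun i => (shift_iterate_apply n _ i).trans (hzx i)), hzy⟩

variable (F) in
/-- The first `F.window` letters of a point. Two points that begin with the same such word have
the same pasts. -/
def initialWord (x : F.space) : Fin F.window → Fin q := fun i => x.1 i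

theorem exists_iterate_eq_of_initialWord_eq {n : ℕ} (hn : 0 < n) {y : F.space}
    (h : F.initialWord (F.shift^[n] y) = F.initialWord y) :
    ∃ p : F.space, F.shift^[n] p = p ∧ p.1 ∈ PiNat.cylinder y.1 (n + F.window) := by
  have hy : ∀ i < n + F.window, y.1 (i % n) = y.1 i := fun i => by
    induction i using Nat.strong_induction_on with
    | _ i ih =>
      intro hi
      rcases lt_or_ge i n with hin | hin
      · rw [Nat.mod_eq_of_lt hin]
      · obtain ⟨j, rfl⟩ := Nat.exists_eq_add_of_le' hin
        rw [Nat.add_mod_right, ih j (by omega) (by omega), ← shift_iterate_apply]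
        exact (congrFun h ⟨j, by omega⟩).symm
  have hp : (fun i => y.1 (i % n)) ∈ F.space := mem_space_of_windows fun k =>
    ⟨F.shift^[k % n] y, fun i hi => by
      have hk := Nat.mod_lt k hn
      rw [← Nat.mod_add_mod, hy _ (by omega), shift_iterate_apply, add_comm]⟩
  refine ⟨⟨_, hp⟩, Subtype.ext (funext fun i => ?_), hy⟩
  rw [shift_iterate_apply]
  exact congrArg y.1 (Nat.add_mod_right i n)

theorem exists_iterate_eq (hne : F.space.Nonempty) :
    ∃ n > 0, ∃ p : F.space, F.shift^[n] p = p := by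
  obtain ⟨x, hx⟩ := hne
  obtain ⟨k, m, hkm, hword⟩ := Set.finite_univ.exists_lt_map_eq_of_forall_mem
    (f := fun k : ℕ => F.initialWord (F.shift^[k] ⟨x, hx⟩)) fun _ => Set.mem_univ _
  obtain ⟨p, hp, -⟩ := exists_iterate_eq_of_initialWord_eq (y := F.shift^[k] ⟨x, hx⟩)
    (Nat.sub_pos_of_lt hkm) (by
      rw [← Function.iterate_add_apply, Nat.sub_add_cancel hkm.le]
      exact hword.symm)
  exact ⟨m - k, Nat.sub_pos_of_lt hkm, p, hp⟩

theorem invariantProb_nonempty (hne : F.space.Nonempty) : F.invariantProb.Nonempty := by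
  obtain ⟨n, hn, p, hp⟩ := exists_iterate_eq hne
  obtain ⟨ν, hν, hνT, -⟩ := exists_invariantProb_of_iterate_eq continuous_shift.measurable hn hp
  exact ⟨ν, hν, hνT⟩

end SFT

/-! ### Maximizing measures and sub-actions -/

namespace SFT

variable {q : ℕ} {F : SFT q} {A e : F.space → ℝ} {v : ℕ → ℝ} {μ ν : Measure F.space}

/-- `A` varies by at most `v k` on each cylinder of length `k`. Summability of `v` is what keeps the
distortion of Birkhoff sums bounded. -/
def HasVariation (v : ℕ → ℝ) (A : F.space → ℝ) : Prop :=
  ∀ (x y : F.space) (k : ℕ), y.1 ∈ PiNat.cylinder x.1 k → |A x - A y| ≤ v k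

theorem continuous_of_le_add_of_mem_cylinder (hv : Tendsto v atTop (𝓝 0)) {N : ℕ}
    (h : ∀ x y : F.space, ∀ k ≥ N, y.1 ∈ PiNat.cylinder x.1 k → A x ≤ A y + v k) :
    Continuous A := by
  refine continuous_iff_continuousAt.2 fun x => Metric.tendsto_nhds.2 fun ε hε => ?_
  obtain ⟨k, hvk, hkN⟩ := ((hv.eventually_lt_const hε).and (eventually_ge_atTop N)).exists
  have hx : ∀ᶠ y : F.space in 𝓝 x, y.1 ∈ PiNat.cylinder x.1 k :=
    continuous_subtype_val.continuousAt.eventually_mem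
      ((PiNat.isOpen_cylinder _ _ _).mem_nhds (PiNat.self_mem_cylinder _ _))
  filter_upwards [hx] with y hy
  rw [Real.dist_eq, abs_sub_lt_iff]
  constructor
  · linarith [h y x k hkN ((PiNat.mem_cylinder_comm _ _ _).1 hy)]
  · linarith [h x y k hkN hy]

theorem HasVariation.continuous (hv : Tendsto v atTop (𝓝 0)) (hA : HasVariation v A) :
    Continuous A :=
  continuous_of_le_add_of_mem_cylinder (N := 0) hv fun x y k _ hy =>
    sub_le_iff_le_add'.1 (le_of_abs_le (hA x y k hy))

theorem HasVariation.sub_const (hA : HasVariation v A) (c : ℝ) :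
    HasVariation v fun x => A x - c := by
  simpa only [HasVariation, sub_sub_sub_cancel_right] using hA

theorem HasVariation.birkhoffSum_le_add_tsum (hv : Summable v) (hA : HasVariation v A) (n N : ℕ)
    {x y : F.space} (hxy : y.1 ∈ PiNat.cylinder x.1 (n + N)) :
    birkhoffSum F.shift A n x ≤ birkhoffSum F.shift A n y + ∑' i, v (i + N) := by
  have hv_nonneg : ∀ k, 0 ≤ v k := fun k =>
    (abs_nonneg _).trans (hA x x k (PiNat.self_mem_cylinder _ _))
  rw [← sub_le_iff_le_add', birkhoffSum, birkhoffSum, ← Finset.sum_sub_distrib]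
  calc ∑ j ∈ Finset.range n, (A (F.shift^[j] x) - A (F.shift^[j] y))
      ≤ ∑ j ∈ Finset.range n, v (n - 1 - j + N) := Finset.sum_le_sum fun j hj => by
        have hj := Finset.mem_range.1 hj
        refine le_of_abs_le (hA _ _ _ fun i hi => ?_)
        rw [shift_iterate_apply, shift_iterate_apply]
        exact hxy _ (by omega)
    _ = ∑ j ∈ Finset.range n, v (j + N) := Finset.sum_range_reflect (fun j => v (j + N)) n
    _ ≤ ∑' i, v (i + N) :=
        ((summable_nat_add_iff N).2 hv).sum_le_tsum _ fun i _ => hv_nonneg _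

theorem HasVariation.exists_birkhoffSum_le (hv : Summable v) (hA : HasVariation v A)
    (hperiodic : ∀ n > 0, ∀ p, F.shift^[n] p = p → birkhoffSum F.shift A n p ≤ 0) :
    ∃ C, ∀ n x, birkhoffSum F.shift A n x ≤ C := by
  obtain ⟨D, hD⟩ := (isCompact_range (hA.continuous hv.tendsto_atTop_zero)).bddAbove
  have hD : ∀ x, A x ≤ max D 0 := fun x => (hD ⟨x, rfl⟩).trans (le_max_left _ _)
  let K := max (∑' i, v (i + F.window)) 0
  have hreturn : ∀ n x, F.initialWord (F.shift^[n] x) = F.initialWord x →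
      birkhoffSum F.shift A n x ≤ K := fun n x hx => by
    rcases n.eq_zero_or_pos with rfl | hn
    · exact le_max_right _ _
    · obtain ⟨p, hp, hpx⟩ := exists_iterate_eq_of_initialWord_eq hn hx
      calc birkhoffSum F.shift A n x
          ≤ birkhoffSum F.shift A n p + ∑' i, v (i + F.window) :=
            hA.birkhoffSum_le_add_tsum hv n F.window hpx
        _ ≤ 0 + K := add_le_add (hperiodic n hn p hp) (le_max_left _ _)
        _ = K := zero_add K
  exact ⟨_, fun n x => birkhoffSum_le_card_mul (le_max_right D 0) hD hreturn Finset.univ n x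
    fun _ _ => Finset.mem_univ _⟩

variable (F) in
/-- The largest integral of `A` with respect to an invariant probability, often written `β(A)`. -/
noncomputable def maxIntegral (A : F.space → ℝ) : ℝ :=
  sSup ((fun ν : Measure F.space => ∫ x, A x ∂ν) '' F.invariantProb)

theorem integral_eq_maxIntegral (hμ : μ ∈ F.maximizingMeasures A) :
    ∫ x, A x ∂μ = F.maxIntegral A := by
  have hmax : IsGreatest ((fun ν : Measure F.space => ∫ x, A x ∂ν) '' F.invariantProb)
      (∫ x, A x ∂μ) := ⟨⟨μ, hμ.1, rfl⟩, Set.forall_mem_image.2 hμ.2⟩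
  exact hmax.csSup_eq.symm

theorem maximizingMeasures_nonempty (hne : F.invariantProb.Nonempty) (hA : Continuous A) :
    (F.maximizingMeasures A).Nonempty :=
  exists_invariantProb_forall_integral_le continuous_shift hne hA

theorem integral_le_maxIntegral (hA : Continuous A) (hν : ν ∈ F.invariantProb) :
    ∫ x, A x ∂ν ≤ F.maxIntegral A := by
  obtain ⟨μ, hμ⟩ := maximizingMeasures_nonempty ⟨ν, hν⟩ hA
  exact (hμ.2 ν hν).trans_eq (integral_eq_maxIntegral hμ)

theorem mem_maximizingMeasures_iff (hA : Continuous A) (hν : ν ∈ F.invariantProb) :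
    ν ∈ F.maximizingMeasures A ↔ ∫ x, A x ∂ν = F.maxIntegral A :=
  ⟨integral_eq_maxIntegral, fun h =>
    ⟨hν, fun _ hη => (integral_le_maxIntegral hA hη).trans_eq h.symm⟩⟩

theorem maxIntegral_le_add {B : F.space → ℝ} {c : ℝ} (hne : F.invariantProb.Nonempty)
    (hA : Continuous A) (hB : Continuous B) (hAB : ∀ x, A x ≤ B x + c) :
    F.maxIntegral A ≤ F.maxIntegral B + c := by
  obtain ⟨μ, hμ⟩ := maximizingMeasures_nonempty hne hA
  have := hμ.1.1
  have hBμ := integrable_of_continuous_of_compactSpace hB μ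
  calc F.maxIntegral A = ∫ x, A x ∂μ := (integral_eq_maxIntegral hμ).symm
    _ ≤ ∫ x, (B x + c) ∂μ := integral_mono (integrable_of_continuous_of_compactSpace hA μ)
        (hBμ.add (integrable_const c)) hAB
    _ = ∫ x, B x ∂μ + c := by simp [integral_add hBμ (integrable_const c)]
    _ ≤ F.maxIntegral B + c := by gcongr; exact integral_le_maxIntegral hB hμ.1

theorem birkhoffSum_le_mul_maxIntegral (hA : Continuous A) {n : ℕ} (hn : 0 < n) {p : F.space}
    (hp : F.shift^[n] p = p) : birkhoffSum F.shift A n p ≤ n * F.maxIntegral A := by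
  obtain ⟨ν, hν, hνT, hint⟩ :=
    exists_invariantProb_of_iterate_eq continuous_shift.measurable hn hp
  rw [← div_le_iff₀' (Nat.cast_pos.2 hn), ← hint A]
  exact integral_le_maxIntegral hA ⟨hν, hνT⟩

/-- The Birkhoff sums of `A` along the orbit segments that end at `x`. Their supremum is the
sub-action in the proof of Mañé's lemma. -/
def pastSums (A : F.space → ℝ) (x : F.space) : Set ℝ :=
  {r | ∃ n y, F.shift^[n] y = x ∧ birkhoffSum F.shift A n y = r}

theorem pastSums_nonempty (A : F.space → ℝ) (x : F.space) : (pastSums A x).Nonempty :=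
  ⟨_, 0, x, rfl, rfl⟩

theorem HasVariation.sSup_pastSums_le_add (hv : Summable v) (hA : HasVariation v A)
    {x y : F.space} (hbdd : BddAbove (pastSums A y)) {k : ℕ} (hk : F.window ≤ k)
    (hxy : y.1 ∈ PiNat.cylinder x.1 k) :
    sSup (pastSums A x) ≤ sSup (pastSums A y) + ∑' i, v (i + k) := by
  refine csSup_le (pastSums_nonempty A x) ?_
  rintro _ ⟨n, z, rfl, rfl⟩
  obtain ⟨z', hz', hzz'⟩ := exists_replace_tail n z y hk ((PiNat.mem_cylinder_comm _ _ _).1 hxy)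
  exact (hA.birkhoffSum_le_add_tsum hv n k hzz').trans
    (add_le_add_left (le_csSup hbdd ⟨n, z', hz', rfl⟩) _)

theorem add_sSup_pastSums_le {x : F.space} (hbdd : BddAbove (pastSums A (F.shift x))) :
    A x + sSup (pastSums A x) ≤ sSup (pastSums A (F.shift x)) := by
  rw [← le_sub_iff_add_le']
  refine csSup_le (pastSums_nonempty A x) ?_
  rintro _ ⟨n, y, rfl, rfl⟩
  rw [le_sub_iff_add_le, ← birkhoffSum_succ]
  exact le_csSup hbdd ⟨n + 1, y, Function.iterate_succ_apply' _ _ _, rfl⟩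

theorem HasVariation.exists_subaction (hv : Summable v) (hA : HasVariation v A) :
    ∃ V : F.space → ℝ, Continuous V ∧ ∀ x, A x + V x ≤ V (F.shift x) + F.maxIntegral A := by
  let B : F.space → ℝ := fun x => A x - F.maxIntegral A
  have hB : HasVariation v B := hA.sub_const _
  obtain ⟨C, hC⟩ := hB.exists_birkhoffSum_le hv fun n hn p hp => by
    have hAp := birkhoffSum_le_mul_maxIntegral (hA.continuous hv.tendsto_atTop_zero) hn hp
    simpa [B, birkhoffSum] using hAp
  have hbdd : ∀ x, BddAbove (pastSums B x) := fun x => ⟨C, by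
    rintro _ ⟨n, y, -, rfl⟩
    exact hC n y⟩
  refine ⟨fun x => sSup (pastSums B x), ?_, fun x => ?_⟩
  · exact continuous_of_le_add_of_mem_cylinder (tendsto_sum_nat_add v) fun x y k hk =>
      hB.sSup_pastSums_le_add hv (hbdd y) hk
  · linarith [add_sSup_pastSums_le (hbdd (F.shift x))]

theorem HasVariation.mem_maximizingMeasures_of_support (hv : Summable v) (hA : HasVariation v A)
    (hμ : μ ∈ F.maximizingMeasures A) (hν : ν ∈ F.invariantProb) (hνμ : ν μ.supportᶜ = 0) :
    ν ∈ F.maximizingMeasures A := by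
  have := hμ.1.1
  have := hν.1
  have hA_cont : Continuous A := hA.continuous hv.tendsto_atTop_zero
  obtain ⟨V, hV, hAV⟩ := hA.exists_subaction hv
  rw [mem_maximizingMeasures_iff hA_cont hν]
  exact integral_eq_of_support_of_le_coboundary continuous_shift hA_cont hV hAV hμ.1.2 hν.2
    (integral_eq_maxIntegral hμ) hνμ

theorem maxIntegral_add_mul_integral_le (hA : Continuous A) (he : Continuous e)
    (hμ : μ ∈ F.maximizingMeasures A) (t : ℝ) :
    F.maxIntegral A + t * ∫ x, e x ∂μ ≤ F.maxIntegral (A + t • e) := by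
  have := hμ.1.1
  calc F.maxIntegral A + t * ∫ x, e x ∂μ = ∫ x, (A + t • e) x ∂μ := by
        simp only [Pi.add_apply, Pi.smul_apply, smul_eq_mul]
        rw [integral_add (integrable_of_continuous_of_compactSpace hA μ)
          ((integrable_of_continuous_of_compactSpace he μ).const_mul t), integral_const_mul,
          integral_eq_maxIntegral hμ]
    _ ≤ F.maxIntegral (A + t • e) := integral_le_maxIntegral (by fun_prop) hμ.1

theorem integral_eq_of_isSmoothAlong (hA : Continuous A) (he : Continuous e)
    (h : IsSmoothAlong F.maxIntegral e A) (hμ : μ ∈ F.maximizingMeasures A)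
    (hν : ν ∈ F.maximizingMeasures A) : ∫ x, e x ∂μ = ∫ x, e x ∂ν := by
  wlog hlt : ∫ x, e x ∂ν < ∫ x, e x ∂μ generalizing μ ν
  · rcases lt_trichotomy (∫ x, e x ∂μ) (∫ x, e x ∂ν) with h' | h' | h'
    · exact (this hν hμ h').symm
    · exact h'
    · exact absurd h' hlt
  obtain ⟨t, -, ht⟩ := h _ (sub_pos.2 hlt)
  have hpos := maxIntegral_add_mul_integral_le hA he hμ t
  have hneg := maxIntegral_add_mul_integral_le hA he hν (-t)
  rw [neg_smul, ← sub_eq_add_neg] at hneg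
  linarith

theorem preimage_val_piNatCylinder (x : ℕ → Fin q) (n : ℕ) :
    (Subtype.val ⁻¹' PiNat.cylinder x n : Set F.space) = F.cylinder fun i : Fin n => x i := by
  ext y
  simp only [Set.mem_preimage, PiNat.mem_cylinder_iff, cylinder, Set.mem_ofPred_eq, Fin.forall_iff]

theorem ext_of_cylinder [IsProbabilityMeasure μ] [IsProbabilityMeasure ν]
    (h : ∀ (n : ℕ) (w : Fin n → Fin q), μ (F.cylinder w) = ν (F.cylinder w)) : μ = ν := by
  have hbasis := (PiNat.isTopologicalBasis_cylinders fun _ => Fin q).induced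
    (Subtype.val : F.space → ℕ → Fin q)
  refine ext_of_generate_finite _
    ((BorelSpace.measurable_eq (α := F.space)).trans hbasis.borel_eq_generateFrom) ?_ ?_ (by simp)
  · rintro _ ⟨_, ⟨x, n, rfl⟩, rfl⟩ _ ⟨_, ⟨y, m, rfl⟩, rfl⟩ ⟨z, hzx, hzy⟩
    refine ⟨_, ⟨z, max n m, rfl⟩, ?_⟩
    rw [← PiNat.mem_cylinder_iff_eq.1 hzx, ← PiNat.mem_cylinder_iff_eq.1 hzy]
    ext u
    simp only [Set.mem_preimage, Set.mem_inter_iff, PiNat.mem_cylinder_iff, lt_max_iff, or_imp,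
      forall_and]
  · rintro _ ⟨_, ⟨x, n, rfl⟩, rfl⟩
    rw [preimage_val_piNatCylinder]
    exact h n _

theorem eq_of_forall_isSmoothAlong_indicator (hA : Continuous A)
    (h : ∀ (n : ℕ) (w : Fin n → Fin q),
      IsSmoothAlong F.maxIntegral ((F.cylinder w).indicator 1) A)
    (hμ : μ ∈ F.maximizingMeasures A) (hν : ν ∈ F.maximizingMeasures A) : μ = ν := by
  have := hμ.1.1
  have := hν.1.1
  refine ext_of_cylinder fun n w => (measureReal_eq_measureReal_iff).1 ?_
  have hw : MeasurableSet (F.cylinder w) := (isClopen_cylinder w).isOpen.measurableSet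
  rw [← integral_indicator_one hw, ← integral_indicator_one hw]
  exact integral_eq_of_isSmoothAlong hA
    ((isClopen_cylinder w).continuous_indicator continuous_one) (h n w) hμ hν

theorem HasVariation.uniquelyErgodicOn_support (hv : Summable v) (hA : HasVariation v A)
    (hμ : F.maximizingMeasures A = {μ}) : F.UniquelyErgodicOn μ.support := by
  have hμA : μ ∈ F.maximizingMeasures A := hμ ▸ rfl
  refine ⟨mapsTo_support_of_measurePreserving continuous_shift hμA.1.2, μ,
    ⟨hμA.1, Measure.measure_compl_support⟩, ?_⟩
  rintro ν ⟨hν, hνμ⟩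
  exact hμ.subset (hA.mem_maximizingMeasures_of_support hv hμA hν hνμ)

end SFT

/-! ### Topological pressure -/

namespace SFT

variable {q : ℕ} {F : SFT q} {A B : F.space → ℝ} {D E c : ℝ}

theorem partitionFunction_le_exp_mul (hB : ∀ x, B x ≤ D) (hAB : ∀ x, A x ≤ B x + c) (n : ℕ) :
    F.partitionFunction A n ≤ Real.exp (n * c) * F.partitionFunction B n := by
  classical
  rw [partitionFunction, partitionFunction, Finset.mul_sum]
  refine Finset.sum_le_sum fun w hw => ?_
  rw [← Real.exp_add, Real.exp_le_exp, add_comm]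
  refine csSup_le ((Finset.mem_filter.1 hw).2.image _) (Set.forall_mem_image.2 fun x hx => ?_)
  have hbdd : BddAbove (birkhoffSum F.shift B n '' F.cylinder w) :=
    ⟨n * D, Set.forall_mem_image.2 fun y _ => by
      simpa [birkhoffSum] using birkhoffSum_le_add_mul (g := fun _ => 0) (by simpa using hB) n y⟩
  exact (birkhoffSum_le_add_mul hAB n x).trans (add_le_add_left (le_csSup hbdd ⟨x, hx, rfl⟩) _)

theorem partitionFunction_zero (n : ℕ) :
    F.partitionFunction 0 n = {w : Fin n → Fin q | (F.cylinder w).Nonempty}.ncard := by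
  classical
  rw [partitionFunction, Set.ncard_eq_toFinset_card', Set.toFinset_ofPred, Finset.cast_card]
  refine Finset.sum_congr (by congr) fun w hw => ?_
  have hzero : birkhoffSum F.shift (0 : F.space → ℝ) n = fun _ => 0 := by
    ext x
    simp [birkhoffSum]
  rw [hzero, (Finset.mem_filter.1 hw).2.image_const, csSup_singleton, Real.exp_zero]

theorem partitionFunction_pos (hne : F.space.Nonempty) (A : F.space → ℝ) (n : ℕ) :
    0 < F.partitionFunction A n := by
  classical
  obtain ⟨x, hx⟩ := hne
  exact Finset.sum_pos (fun w _ => Real.exp_pos _)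
    ⟨fun i => x i, Finset.mem_filter.2 ⟨Finset.mem_univ _, ⟨x, hx⟩, fun i => rfl⟩⟩

theorem log_partitionFunction_div_le_add (hne : F.space.Nonempty) (hB : ∀ x, B x ≤ D)
    (hAB : ∀ x, A x ≤ B x + c) {n : ℕ} (hn : 0 < n) :
    Real.log (F.partitionFunction A n) / n ≤ Real.log (F.partitionFunction B n) / n + c := by
  have hn : (0 : ℝ) < n := Nat.cast_pos.2 hn
  rw [div_add' _ _ _ hn.ne', div_le_div_iff_of_pos_right hn]
  calc Real.log (F.partitionFunction A n)
      ≤ Real.log (Real.exp (n * c) * F.partitionFunction B n) :=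
        Real.log_le_log (partitionFunction_pos hne A n) (partitionFunction_le_exp_mul hB hAB n)
    _ = Real.log (F.partitionFunction B n) + c * n := by
        rw [Real.log_mul (Real.exp_pos _).ne' (partitionFunction_pos hne B n).ne', Real.log_exp,
          add_comm, mul_comm c]

theorem log_partitionFunction_zero_div_mem_Icc (hne : F.space.Nonempty) {n : ℕ} (hn : 0 < n) :
    Real.log (F.partitionFunction 0 n) / n ∈ Set.Icc 0 (Real.log q) := by
  have hn : (0 : ℝ) < n := Nat.cast_pos.2 hn
  have hpos := partitionFunction_pos hne 0 n
  have hle : F.partitionFunction 0 n ≤ (q : ℝ) ^ n := by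
    rw [partitionFunction_zero]
    exact_mod_cast (Set.ncard_le_card _).trans_eq (by simp)
  refine ⟨div_nonneg (Real.log_nonneg ?_) hn.le, ?_⟩
  · rw [partitionFunction_zero] at hpos ⊢
    exact_mod_cast hpos
  · rw [div_le_iff₀ hn, mul_comm, ← Real.log_pow]
    exact Real.log_le_log hpos hle

theorem log_partitionFunction_div_mem_Icc (hne : F.space.Nonempty) (hA : ∀ x, |A x| ≤ D) {n : ℕ}
    (hn : 0 < n) : Real.log (F.partitionFunction A n) / n ∈ Set.Icc (-D) (Real.log q + D) := by
  have hzero := log_partitionFunction_zero_div_mem_Icc hne hn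
  have hlower := log_partitionFunction_div_le_add (A := 0) (B := A) (c := D) hne
    (fun x => (abs_le.1 (hA x)).2) (fun x => neg_le_iff_add_nonneg.1 (abs_le.1 (hA x)).1) hn
  have hupper := log_partitionFunction_div_le_add (A := A) (B := 0) (c := D) hne
    (fun x => le_rfl) (fun x => by simpa using (abs_le.1 (hA x)).2) hn
  exact ⟨by linarith [hzero.1], by linarith [hzero.2]⟩

theorem isBoundedUnder_log_partitionFunction_div (hne : F.space.Nonempty)
    (hA : ∀ x, |A x| ≤ D) :
    IsBoundedUnder (· ≤ ·) atTop (fun n : ℕ => Real.log (F.partitionFunction A n) / n) ∧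
      IsCoboundedUnder (· ≤ ·) atTop (fun n : ℕ => Real.log (F.partitionFunction A n) / n) := by
  have hmem : ∀ᶠ n : ℕ in atTop, Real.log (F.partitionFunction A n) / n ∈ _ :=
    (eventually_gt_atTop 0).mono fun n => log_partitionFunction_div_mem_Icc hne hA
  exact ⟨isBoundedUnder_of_eventually_le (hmem.mono fun n hn => hn.2),
    (isBoundedUnder_of_eventually_ge (hmem.mono fun n hn => hn.1)).isCoboundedUnder_le⟩

theorem pressure_le_add (hne : F.space.Nonempty) (hA : ∀ x, |A x| ≤ D) (hB : ∀ x, |B x| ≤ E)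
    (hAB : ∀ x, A x ≤ B x + c) : F.pressure A ≤ F.pressure B + c := by
  obtain ⟨-, hA_cobdd⟩ := isBoundedUnder_log_partitionFunction_div hne hA
  obtain ⟨hB_bdd, hB_cobdd⟩ := isBoundedUnder_log_partitionFunction_div hne hB
  rw [pressure, pressure, ← limsup_add_const atTop _ c hB_bdd hB_cobdd]
  exact limsup_le_limsup ((eventually_gt_atTop 0).mono fun n =>
      log_partitionFunction_div_le_add hne (fun x => (abs_le.1 (hB x)).2) hAB) hA_cobdd
    (isBoundedUnder_le_add hB_bdd isBoundedUnder_const)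

end SFT

/-! ### Hölder functions -/

namespace SFT

variable {q : ℕ} {F : SFT q} {l α : ℝ} {A : F.space → ℝ}

theorem seqDist_le_pow_iff (hl0 : 0 < l) (hl1 : l < 1) {x y : F.space} {k : ℕ} :
    F.seqDist l x y ≤ l ^ k ↔ y.1 ∈ PiNat.cylinder x.1 k := by
  rcases eq_or_ne x y with rfl | hxy
  · simp [seqDist, hl0.le]
  · rw [seqDist, if_neg hxy, pow_le_pow_iff_right_of_lt_one₀ hl0 hl1, PiNat.mem_cylinder_comm,
      PiNat.mem_cylinder_iff_le_firstDiff (Subtype.coe_injective.ne hxy)]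

theorem IsHolder.hasVariation (hl0 : 0 < l) (hl1 : l < 1) (hα0 : 0 < α)
    (hA : F.IsHolder l α A) : HasVariation (fun k => F.holderSeminorm l α A * (l ^ α) ^ k) A := by
  intro x y k hxy
  have hle : ∀ k, y.1 ∈ PiNat.cylinder x.1 k → F.seqDist l x y ≤ l ^ k := fun k =>
    (seqDist_le_pow_iff hl0 hl1).2
  rcases eq_or_ne x y with rfl | hne
  · rw [sub_self, abs_zero]
    exact mul_nonneg holderSeminorm_nonneg (by positivity)
  have hpos : 0 < F.seqDist l x y := by
    rw [seqDist, if_neg hne]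
    positivity
  have hquot := hA.quot_le x y hpos (by simpa using hle 0 (by simp))
  rw [div_le_iff₀ (by positivity)] at hquot
  beta_reduce
  rw [Real.rpow_pow_comm hl0.le]
  exact hquot.trans (mul_le_mul_of_nonneg_left
    (Real.rpow_le_rpow hpos.le (hle k hxy) hα0.le) holderSeminorm_nonneg)

theorem IsHolder.exists_summable_hasVariation (hl0 : 0 < l) (hl1 : l < 1) (hα0 : 0 < α)
    (hA : F.IsHolder l α A) : ∃ v, Summable v ∧ HasVariation v A :=
  ⟨_, (summable_geometric_of_lt_one (Real.rpow_nonneg hl0.le α)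
    (Real.rpow_lt_one hl0.le hl1 hα0)).mul_left _, hA.hasVariation hl0 hl1 hα0⟩

theorem IsHolder.continuous (hl0 : 0 < l) (hl1 : l < 1) (hα0 : 0 < α) (hA : F.IsHolder l α A) :
    Continuous A := by
  obtain ⟨v, hv, hAv⟩ := hA.exists_summable_hasVariation hl0 hl1 hα0
  exact hAv.continuous hv.tendsto_atTop_zero

theorem isHolder_const (c : ℝ) : F.IsHolder l α fun _ => c := by
  refine ⟨⟨|c|, ?_⟩, ⟨0, ?_⟩⟩
  · rintro _ ⟨x, rfl⟩
    exact le_rfl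
  · rintro _ ⟨x, y, -, -, rfl⟩
    simp

theorem isHolder_indicator_cylinder (hl0 : 0 < l) (hl1 : l < 1) (hα0 : 0 < α) {n : ℕ}
    (w : Fin n → Fin q) : F.IsHolder l α ((F.cylinder w).indicator 1) := by
  classical
  refine ⟨⟨1, ?_⟩, ⟨1 / (l ^ n) ^ α, ?_⟩⟩
  · rintro _ ⟨x, rfl⟩
    by_cases hx : x ∈ F.cylinder w <;> simp [hx]
  · rintro _ ⟨x, y, -, -, rfl⟩
    by_cases hxy : y.1 ∈ PiNat.cylinder x.1 n
    · have hiff : y ∈ F.cylinder w ↔ x ∈ F.cylinder w :=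
        forall_congr' fun i => by rw [PiNat.mem_cylinder_iff.1 hxy i i.2]
      simp only [Set.indicator_apply, hiff, Pi.one_apply, sub_self, abs_zero, zero_div]
      positivity
    · have hdist : l ^ n ≤ F.seqDist l x y :=
        (not_le.1 fun h => hxy ((seqDist_le_pow_iff hl0 hl1).1 h)).le
      have hosc : |(F.cylinder w).indicator (1 : F.space → ℝ) x -
          (F.cylinder w).indicator 1 y| ≤ 1 := by
        by_cases hx : x ∈ F.cylinder w <;> by_cases hy : y ∈ F.cylinder w <;> simp [hx, hy]
      exact div_le_div₀ zero_le_one hosc (by positivity)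
        (Real.rpow_le_rpow (by positivity) hdist hα0.le)

namespace HolderSpace

theorem abs_le_norm (A : F.HolderSpace l α) (x : F.space) : |A x| ≤ ‖A‖ :=
  (IsHolder.abs_le A.2 x).trans (le_add_of_nonneg_left holderSeminorm_nonneg)

instance : NormedSpace ℝ (F.HolderSpace l α) where
  norm_smul_le c A := by
    have hbound : 0 ≤ ‖c‖ * F.holderSeminorm l α A :=
      mul_nonneg (norm_nonneg c) holderSeminorm_nonneg
    refine (add_le_add (Real.sSup_le ?_ hbound)
      (Real.sSup_le ?_ (mul_nonneg (norm_nonneg c) supNorm_nonneg))).trans_eq (mul_add _ _ _).symm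
    · rintro _ ⟨x, y, hpos, hle, rfl⟩
      change |c * A x - c * A y| / _ ≤ |c| * _
      rw [← mul_sub, abs_mul, mul_div_assoc]
      exact mul_le_mul_of_nonneg_left (IsHolder.quot_le A.2 x y hpos hle) (abs_nonneg c)
    · rintro _ ⟨x, rfl⟩
      change |c * A x| ≤ |c| * _
      rw [abs_mul]
      exact mul_le_mul_of_nonneg_left (IsHolder.abs_le A.2 x) (abs_nonneg c)

instance : One (F.HolderSpace l α) :=
  ⟨⟨fun _ => 1, isHolder_const 1⟩⟩

end HolderSpace

/-- A functional on the Hölder space is topical if it is monotone and additively homogeneous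
(`Φ (A + c) = Φ A + c`); the single inequality below is equivalent to these two properties. -/
def IsTopical (Φ : F.HolderSpace l α → ℝ) : Prop :=
  ∀ (A B : F.HolderSpace l α) (c : ℝ), (∀ x, A x ≤ B x + c) → Φ A ≤ Φ B + c

variable {Φ P : F.HolderSpace l α → ℝ}

theorem IsTopical.lipschitzWith_one (hΦ : IsTopical Φ) : LipschitzWith 1 Φ :=
  LipschitzWith.of_le_add fun A B => hΦ A B _ fun x => by
    rw [dist_eq_norm, ← sub_le_iff_le_add']
    exact (le_abs_self _).trans ((A - B).abs_le_norm x)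

theorem IsTopical.add_smul_one (hΦ : IsTopical Φ) (A : F.HolderSpace l α) (c : ℝ) :
    Φ (A + c • 1) = Φ A + c := by
  have happly : ∀ x, (A + c • 1 : F.HolderSpace l α) x = A x + c := fun x =>
    congrArg (A x + ·) (mul_one c)
  refine le_antisymm (hΦ _ _ c fun x => (happly x).le) ?_
  rw [← le_sub_iff_add_le]
  exact hΦ _ _ (-c) fun x => by rw [happly, add_neg_cancel_right]

theorem isTopical_pressure (hne : F.space.Nonempty) :
    IsTopical fun A : F.HolderSpace l α => F.pressure A :=
  fun A B _ => pressure_le_add hne A.abs_le_norm B.abs_le_norm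

theorem isTopical_maxIntegral (hne : F.space.Nonempty) (hl0 : 0 < l) (hl1 : l < 1) (hα0 : 0 < α) :
    IsTopical fun A : F.HolderSpace l α => F.maxIntegral A :=
  fun A B _ => maxIntegral_le_add (invariantProb_nonempty hne)
    (IsHolder.continuous hl0 hl1 hα0 A.2) (IsHolder.continuous hl0 hl1 hα0 B.2)

theorem setOf_isSmoothAlong_maxIntegral_mem_residual (hne : F.space.Nonempty) (hl0 : 0 < l)
    (hl1 : l < 1) (hα0 : 0 < α) (e : F.HolderSpace l α) :
    {A : F.zeroPressure l α | IsSmoothAlong (fun B : F.HolderSpace l α => F.maxIntegral B) e A} ∈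
      residual (F.zeroPressure l α) :=
  have hmax := isTopical_maxIntegral (F := F) hne hl0 hl1 hα0
  have hP := isTopical_pressure (F := F) (l := l) (α := α) hne
  setOf_isSmoothAlong_mem_residual_zeroLevel hmax.lipschitzWith_one
    hP.lipschitzWith_one.continuous hmax.add_smul_one hP.add_smul_one e

end SFT

theorem theoremA_general {q : ℕ} (F : SFT q) (hne : F.space.Nonempty) (l : ℝ) (hl0 : 0 < l)
    (hl1 : l < 1) (α : ℝ) (hα0 : 0 < α) :
    ∃ G ∈ residual (F.zeroPressure l α), ∀ A ∈ G,
      ∃ μ : Measure F.space,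
        F.maximizingMeasures (A : F.HolderSpace l α) = {μ} ∧ F.UniquelyErgodicOn μ.support := by
  let e : (Σ n : ℕ, Fin n → Fin q) → F.HolderSpace l α := fun w =>
    ⟨(F.cylinder w.2).indicator 1, SFT.isHolder_indicator_cylinder hl0 hl1 hα0 w.2⟩
  refine ⟨{A | ∀ w, IsSmoothAlong (fun B : F.HolderSpace l α => F.maxIntegral B) (e w) A},
    eventually_countable_forall.2 fun w =>
      SFT.setOf_isSmoothAlong_maxIntegral_mem_residual hne hl0 hl1 hα0 (e w), fun A hA => ?_⟩
  have hcont : Continuous A.1.1 := SFT.IsHolder.continuous hl0 hl1 hα0 A.1.2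
  obtain ⟨μ, hμ⟩ := SFT.maximizingMeasures_nonempty (SFT.invariantProb_nonempty hne) hcont
  have huniq : F.maximizingMeasures A.1 = {μ} :=
    Set.eq_singleton_iff_unique_mem.2 ⟨hμ, fun ν hν =>
      SFT.eq_of_forall_isSmoothAlong_indicator hcont (fun n w => hA ⟨n, w⟩) hν hμ⟩
  obtain ⟨v, hv, hAv⟩ := SFT.IsHolder.exists_summable_hasVariation hl0 hl1 hα0 A.1.2
  exact ⟨μ, huniq, hAv.uniquelyErgodicOn_support hv huniq⟩

theorem theoremA {q : ℕ} (F : SFT q) (hne : F.space.Nonempty) (hmix : F.TopologicallyMixing)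
    (l : ℝ) (hl0 : 0 < l) (hl1 : l < 1) (α : ℝ) (hα0 : 0 < α) (hα1 : α ≤ 1) :
    ∃ G ∈ residual (F.zeroPressure l α), ∀ A ∈ G,
      ∃ μ : Measure F.space,
        F.maximizingMeasures (A : F.HolderSpace l α) = {μ} ∧ F.UniquelyErgodicOn μ.support :=
  theoremA_general F hne l hl0 hl1 α hα0
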